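/- Let $G$ be a compact Lie group whose Lie algebra $\mathfrak g$ is semisimple, let $M$ be a finite-dimensional smooth manifold, possibly with boundary, and let $\pi\colon P\to M$ be a smooth principal $G$-bundle (with $G$ acting on $P$ from the right). Let $A$ be a principal connection on $P$, given by its connection form $\mathbf A\in\Omega^1(P,\mathfrak g)$, which satisfies $\mathbf A(\xi_P)=\xi$ for every infinitesimal generator $\xi_P(p)=\frac{d}{dt}\big|_{0}\,p\cdot\exp(t\xi)$, and $R_g^*\mathbf A=\mathrm{Ad}_{g^{-1}}\circ\mathbf A$ for $g\in G$, where $R_g(p)=p\cdot g$. Let $\tilde{\mathfrak g}=(P\times\mathfrak g)/G\to M$ be the adjoint bundle, the quotient by $(p,\xi)\sim(p\cdot g,\mathrm{Ad}_{g^{-1}}\xi)$, with classes $[p,\xi]$. Let $K$ be the symmetric bilinear form on the fibers of $\tilde{\mathfrak g}$ induced by the Killing form $\kappa$ of $\mathfrak g$, $K([p,\xi],[p,\zeta])=\kappa(\xi,\zeta)$, and let $\flat_K\colon\tilde{\mathfrak g}\to\tilde{\mathfrak g}^*$, $\flat_K(e)=K(e,\cdot)$. Let $\nabla^A$ be the linear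 connection on $\tilde{\mathfrak g}$ induced by $A$: if $\sigma(\pi(p))=[p,s(p)]$ with $s\colon P\to\mathfrak g$, then $\nabla^A_v\sigma=[p,ds(v^h_p)]$ for $v\in T_{\pi(p)}M$, where $v^h_p\in T_pP$ is the horizontal lift of $v$, i.e. $d\pi(v^h_p)=v$ and $\mathbf A(v^h_p)=0$. Let $\nabla^{A*}$ be the dual connection on $\tilde{\mathfrak g}^*$, $d\langle\eta,\sigma\rangle=\langle\nabla^{A*}\eta,\sigma\rangle+\langle\eta,\nabla^A\sigma\rangle$, and let $$d^A\colon\Omega^k(M,\tilde{\mathfrak g})\to\Omega^{k+1}(M,\tilde{\mathfrak g}),\qquad d^{A*}\colon\Omega^k(M,\tilde{\mathfrak g}^*)\to\Omega^{k+1}(M,\tilde{\mathfrak g}^*)$$ be the covariant exterior derivatives of $\nabla^A$ and $\nabla^{A*}$. Then $\nabla^A$ is a metric connection with respect to $K$, that is, $$d\big(K(\sigma,\tau)\big)=K(\nabla^A\sigma,\tau)+K(\sigma,\nabla^A\tau)$$ for all sections $\sigma,\tau$ of $\tilde{\mathfrak g}$, at every point at which both are differentiable. Moreover $\flat_K\circ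 d^A=d^{A*}\circ\flat_K$: for every $k\ge 0$ and every smooth $\varphi\in\Omega^k(M,\tilde{\mathfrak g})$, $$\flat_K(d^A\varphi)=d^{A*}(\flat_K\varphi)\quad\text{in }\Omega^{k+1}(M,\tilde{\mathfrak g}^*).$$ -/

import Mathlib

open Bundle Manifold ContDiff VectorField
open scoped Topology

set_option linter.unusedSectionVars false

namespace MetricConnection
noncomputable section

section Generic
variable {E : Type*} [NormedAddCommGroup E] [NormedSpace ℝ E] [FiniteDimensional ℝ E]
  {H : Type*} [TopologicalSpace H] {I : ModelWithCorners ℝ E H}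
  {M : Type*} [TopologicalSpace M] [ChartedSpace H M]
  {F : Type*} [NormedAddCommGroup F] [NormedSpace ℝ F]
  {V : M → Type*} [TopologicalSpace (TotalSpace F V)]
  [∀ x, AddCommGroup (V x)] [∀ x, Module ℝ (V x)]
  [∀ x, TopologicalSpace (V x)] [∀ x, IsTopologicalAddGroup (V x)] [∀ x, ContinuousSMul ℝ (V x)]
  [FiberBundle F V]

variable (I F) in
/-- The section `σ` of the vector bundle `V` is differentiable at `x`. -/
def DiffAt (σ : Π x, V x) (x : M) : Prop :=
  MDifferentiableAt I (I.prod 𝓘(ℝ, F)) (fun y => TotalSpace.mk' F y (σ y)) x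

variable (I F) in
/-- The section `σ` of the vector bundle `V` is smooth on the set `U`. -/
def SmoothOn (σ : Π x, V x) (U : Set M) : Prop :=
  ContMDiffOn I (I.prod 𝓘(ℝ, F)) ∞ (fun y => TotalSpace.mk' F y (σ y)) U

variable (V) in
/-- The fibers of the dual bundle. Its total space carries Mathlib's vector bundle structure of
the bundle of continuous linear maps from `V` to the trivial line bundle. -/
abbrev Dual (x : M) : Type _ := V x →L[ℝ] ℝ

variable [VectorBundle ℝ F V]

/-- The pairing of differentiable sections of `V` and of its dual is differentiable. -/
theorem DiffAt.pairing {η : Π x, Dual V x} {ξ : Π x, V x} {x : M}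
    (hη : DiffAt I (F →L[ℝ] ℝ) η x) (hξ : DiffAt I F ξ x) :
    MDifferentiableAt I 𝓘(ℝ, ℝ) (fun y => η y (ξ y)) x := by
  have := MDifferentiableAt.clm_bundle_apply (F₁ := F) (E₁ := V) (E₂ := Trivial M ℝ) (F₂ := ℝ) (b := fun y => y) (ϕ := η) hη hξ
  rw [mdifferentiableAt_totalSpace] at this
  exact this.2

variable [FiniteDimensional ℝ F] [ContMDiffVectorBundle 1 F V I]

/-- `(d(η · ξ) - η · ∇ξ)(v)`, which is the value of `(∇*_v η) · ξ` at `x`. -/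
def dualAux (D : CovariantDerivative I F V) (η : Π x, Dual V x) (x : M) (v : TangentSpace I x)
    (ξ : Π x, V x) : ℝ :=
  mvfderiv I (fun y => η y (ξ y)) x v - η x (D ξ x v)

theorem tensorialAt_dualAux (D : CovariantDerivative I F V) {η : Π x, Dual V x} {x : M}
    (hη : DiffAt I (F →L[ℝ] ℝ) η x) (v : TangentSpace I x) :
    TensorialAt I F (dualAux D η x v) x where
  smul {f σ} hf hσ := by
    have h := D.isCovariantDerivativeOnUniv.leibniz hσ hf
    have h1 := mvfderiv_mul hf (hη.pairing hσ)
    have h2 : (fun y => η y ((f • σ) y)) = f * (fun y => η y (σ y)) := by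
      ext y; simp
    simp only [dualAux, h, h2, h1]
    simp
    ring
  add {σ τ} hσ hτ := by
    have h := D.isCovariantDerivativeOnUniv.add hσ hτ
    have h1 := mvfderiv_add (hη.pairing hσ) (hη.pairing hτ)
    have h2 : (fun y => η y ((σ + τ) y)) = (fun y => η y (σ y)) + (fun y => η y (τ y)) := by
      ext y; simp
    simp only [dualAux, h, h2, h1]
    simp
    ring

instance (x : M) : FiniteDimensional ℝ (TangentSpace I x) := inferInstanceAs (FiniteDimensional ℝ E)
instance (x : M) : T2Space (TangentSpace I x) := inferInstanceAs (T2Space E)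

open Classical in
/-- The value at `x` of `∇* η`, for a section `η` of the dual bundle that is differentiable at `x`
(and zero otherwise): the covector `(∇*_v η)` on `V x` is `e ↦ d(η · ξ)(v) - η · ∇_v ξ`, where `ξ`
is any section differentiable at `x` with `ξ x = e`. The value does not depend on `ξ`, since
the expression is tensorial in `ξ`. -/
def dualFun (D : CovariantDerivative I F V) (η : Π x, Dual V x) (x : M) :
    TangentSpace I x →L[ℝ] Dual V x :=
  if hη : DiffAt I (F →L[ℝ] ℝ) η x then
    LinearMap.toContinuousLinearMap
      { toFun := fun v => TensorialAt.mkHom _ x (tensorialAt_dualAux D hη v)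
        map_add' := fun v w => by
          ext e
          simp [TensorialAt.mkHom_apply_eq_extend, dualAux]
          ring
        map_smul' := fun c v => by
          ext e
          simp [TensorialAt.mkHom_apply_eq_extend, dualAux]
          ring }
  else 0

theorem dualFun_apply (D : CovariantDerivative I F V) {η : Π x, Dual V x} {x : M}
    (hη : DiffAt I (F →L[ℝ] ℝ) η x) (v : TangentSpace I x) (e : V x) :
    dualFun D η x v e = dualAux D η x v (FiberBundle.extend F e) := by
  rw [dualFun, dif_pos hη]
  rfl

/-- The dual connection `∇*` of `∇`, determined by `d(η · ξ) = ∇*η · ξ + η · ∇ξ`. -/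
def dualConnection (D : CovariantDerivative I F V) :
    CovariantDerivative I (F →L[ℝ] ℝ) (Dual V) where
  toFun := dualFun D
  isCovariantDerivativeOnUniv :=
    { add := fun {σ τ x} hσ hτ _ => by
        ext v e
        have he : DiffAt I F (FiberBundle.extend F e) x := FiberBundle.mdifferentiableAt_extend I F e
        have hst : DiffAt I (F →L[ℝ] ℝ) (σ + τ) x := mdifferentiableAt_add_section hσ hτ
        have h1 := mvfderiv_add (DiffAt.pairing hσ he) (DiffAt.pairing hτ he)
        simp only [add_apply]
        rw [dualFun_apply D hst, dualFun_apply D hσ, dualFun_apply D hτ]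
        have h2 : (fun y => (σ + τ) y (FiberBundle.extend F e y)) =
          (fun y => σ y (FiberBundle.extend F e y)) + (fun y => τ y (FiberBundle.extend F e y)) := by
          ext y; simp
        simp only [dualAux, h2, h1]
        simp
        ring
      leibniz := fun {σ f x} hσ hf _ => by
        ext v e
        have he : DiffAt I F (FiberBundle.extend F e) x := FiberBundle.mdifferentiableAt_extend I F e
        have hst : DiffAt I (F →L[ℝ] ℝ) (f • σ) x := hf.smul_section hσ
        have h1 := mvfderiv_mul hf (DiffAt.pairing hσ he)
        simp only [add_apply, smul_apply]
        rw [dualFun_apply D hst, dualFun_apply D hσ]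
        have h2 : (fun y => (f • σ) y (FiberBundle.extend F e y)) =
          f * (fun y => σ y (FiberBundle.extend F e y)) := by
          ext y; simp
        simp only [dualAux, h2, h1]
        simp
        ring }

variable (I V) in
/-- A `k`-form on `M` with values in the vector bundle `V`, not necessarily smooth. -/
abbrev Form (k : ℕ) : Type _ := ∀ x : M, (TangentSpace I x) [⋀^Fin k]→ₗ[ℝ] (V x)

variable [IsManifold I ∞ M]

variable (F) in
/-- The form `φ` is smooth: `φ (X₁, …, X_k)` is a smooth section over every open set `U`, for all
vector fields `X₁, …, X_k` that are smooth on `U`. -/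
def Form.IsSmooth {k : ℕ} (φ : Form I V k) : Prop :=
  ∀ (U : Set M) (X : Fin k → Π x : M, TangentSpace I x), IsOpen U → (∀ i, SmoothOn I E (X i) U) →
    SmoothOn I F (fun x => φ x (fun i => X i x)) U

/-- As `y` varies, the vector field near `x` that takes the value `w` at `x` and has constant
coefficients in the preferred chart at `x`. Any two of these fields commute near `x`. -/
def constField (x y : M) : TangentSpace I x →L[ℝ] TangentSpace I y :=
  (trivializationAt E (TangentSpace I : M → Type _) x).symmL ℝ y ∘L
    (trivializationAt E (TangentSpace I : M → Type _) x).continuousLinearMapAt ℝ x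

variable (F) in
/-- The form `φ` has differentiable coefficients at `x` in the preferred chart at `x`. -/
def Form.DiffAt {k : ℕ} (φ : Form I V k) (x : M) : Prop :=
  ∀ w : Fin k → TangentSpace I x,
    MetricConnection.DiffAt I F (fun y => φ y (fun i => constField x y (w i))) x

/-- The map `(v, w₁, …, w_k) ↦ ∇_v (φ (W₁, …, W_k))` at `x`, where `W_i` is the field with constant
coefficients in the chart at `x` that extends `w_i`. -/
def covPart (D : CovariantDerivative I F V) {k : ℕ} (φ : Form I V k) (x : M) (hφ : φ.DiffAt F x) :
    TangentSpace I x →ₗ[ℝ] (TangentSpace I x) [⋀^Fin k]→ₗ[ℝ] (V x) where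
  toFun v :=
    { toFun := fun w => D (fun y => φ y (fun i => constField x y (w i))) x v
      map_update_add' := fun {inst} w i a b => by
        have hab : (fun y => φ y (fun j => constField x y (Function.update w i (a + b) j)))
            = (fun y => φ y (fun j => constField x y (Function.update w i a j)))
              + (fun y => φ y (fun j => constField x y (Function.update w i b j))) := by
          ext y
          have h (c : TangentSpace I x) : (fun j => constField x y (Function.update w i c j))
              = Function.update (fun j => constField x y (w j)) i (constField x y c) := by
            ext j; by_cases hj : j = i
            · subst hj; simp
            · simp [hj]
          simp only [h, map_add, Pi.add_apply, AlternatingMap.map_update_add]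
        rw [hab, D.isCovariantDerivativeOnUniv.add (hφ _) (hφ _)]
        rfl
      map_update_smul' := fun {inst} w i c a => by
        have hab : (fun y => φ y (fun j => constField x y (Function.update w i (c • a) j)))
            = c • (fun y => φ y (fun j => constField x y (Function.update w i a j))) := by
          ext y
          have h (c : TangentSpace I x) : (fun j => constField x y (Function.update w i c j))
              = Function.update (fun j => constField x y (w j)) i (constField x y c) := by
            ext j; by_cases hj : j = i
            · subst hj; simp
            · simp [hj]
          simp only [h, map_smul, Pi.smul_apply, AlternatingMap.map_update_smul]
        rw [hab, D.isCovariantDerivativeOnUniv.smul_const _ (hφ _)]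
        rfl
      map_eq_zero_of_eq' := fun w i j hw hij => by
        have h0 : (fun y => φ y (fun i => constField x y (w i))) = (0 : Π y, V y) := by
          ext y
          exact (φ y).map_eq_zero_of_eq _ (by simp [hw]) hij
        rw [h0, D.zero]
        rfl }
  map_add' v w := by ext; simp
  map_smul' c v := by ext; simp

open Classical in
/-- The covariant exterior derivative `d^∇` of a form, given by the invariant formula
`(d^∇ φ)(v₀, …, v_k) = ∑ i, (-1)^i ∇_{v_i} (φ (V₀, …, V_{i-1}, V_{i+1}, …, V_k))`,
where `V_i` extends `v_i` with constant coefficients in the chart at `x`, so that the terms of the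
formula which involve the brackets `[V_i, V_j]` vanish. See `extDeriv_apply`. It is set to zero
where the coefficients of `φ` are not differentiable. -/
def extDeriv (D : CovariantDerivative I F V) {k : ℕ} (φ : Form I V k) : Form I V (k + 1) := fun x =>
  if hφ : φ.DiffAt F x then AlternatingMap.alternatizeUncurryFin (covPart D φ x hφ) else 0

theorem extDeriv_apply (D : CovariantDerivative I F V) {k : ℕ} {φ : Form I V k} {x : M}
    (hφ : φ.DiffAt F x) (v : Fin (k + 1) → TangentSpace I x) : extDeriv D φ x v = ∑ i : Fin (k + 1), (-1) ^ (i : ℕ) •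
    D (fun y => φ y (fun j => constField x y (i.removeNth v j))) x (v i) := by
  rw [extDeriv, dif_pos hφ, AlternatingMap.alternatizeUncurryFin_apply]
  rfl

/-- The connection `∇` is metric with respect to the fiberwise bilinear form `b`:
`d(b(σ, τ)) = b(∇σ, τ) + b(σ, ∇τ)`, at every point at which the sections `σ`, `τ` are
differentiable (in particular everywhere, for smooth sections). -/
def IsMetric (D : CovariantDerivative I F V) (b : Π x, V x →L[ℝ] V x →L[ℝ] ℝ) : Prop :=
  ∀ (x : M) (σ τ : Π y, V y), DiffAt I F σ x → DiffAt I F τ x →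
    MDifferentiableAt I 𝓘(ℝ, ℝ) (fun y => b y (σ y) (τ y)) x ∧
    ∀ v : TangentSpace I x, mvfderiv I (fun y => b y (σ y) (τ y)) x v =
      b x (D σ x v) (τ x) + b x (σ x) (D τ x v)

/-- The form `♭ ∘ φ` with values in the dual bundle, where `♭ e = b(e, ·)`. -/
def Form.flat (b : Π x, V x →L[ℝ] V x →L[ℝ] ℝ) {k : ℕ} (φ : Form I V k) : Form I (Dual V) k :=
  fun x => ((b x : V x →L[ℝ] Dual V x) : V x →ₗ[ℝ] Dual V x).compAlternatingMap (φ x)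

end Generic

section Adjoint
variable {E : Type*} [NormedAddCommGroup E] [NormedSpace ℝ E]
  {H : Type*} [TopologicalSpace H] {I : ModelWithCorners ℝ E H}
  {G : Type*} [TopologicalSpace G] [ChartedSpace H G] [Group G]

variable (I) in
/-- The adjoint representation `Ad g : 𝔤 → 𝔤`, the derivative at `1` of `h ↦ g h g⁻¹`. -/
def Ad (g : G) : GroupLieAlgebra I G →L[ℝ] GroupLieAlgebra I G :=
  mfderiv I I (fun h : G => g * h * g⁻¹) 1

variable [LieGroup I ∞ G]

instance : ENat.LEInfty (minSmoothness ℝ 3) := ⟨by simp only [minSmoothness_of_isRCLikeNormedField]; exact ENat.LEInfty.out⟩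
instance : LieGroup I (minSmoothness ℝ 3) G := inferInstance
instance : LieGroup I 1 G := inferInstance

theorem contMDiff_conj (g : G) : ContMDiff I I ∞ (fun h : G => g * h * g⁻¹) :=
  (contMDiff_const.mul contMDiff_id).mul contMDiff_const

theorem mdifferentiableAt_conj (g h : G) : MDifferentiableAt I I (fun h : G => g * h * g⁻¹) h :=
  (contMDiff_conj g).mdifferentiableAt (by simp)

theorem Ad_one : Ad I (1 : G) = ContinuousLinearMap.id ℝ _ := by
  have : (fun h : G => 1 * h * 1⁻¹) = id := by ext; simp
  rw [Ad, this]
  exact mfderiv_id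

theorem Ad_mul (g h : G) : Ad I (g * h) = Ad I g ∘L Ad I h := by
  have h1 : (fun k : G => (g * h) * k * (g * h)⁻¹) =
    (fun k => g * k * g⁻¹) ∘ (fun k => h * k * h⁻¹) := by ext; simp [mul_assoc]
  rw [Ad, h1]
  have := mfderiv_comp_of_eq (I := I) (I' := I) (I'' := I) (x := (1 : G)) (y := (1 : G)) (mdifferentiableAt_conj g 1)
    (mdifferentiableAt_conj h 1) (by simp)
  have h2 : ∀ a b : G, a = b → (mfderiv I I (fun k : G => g * k * g⁻¹) a : E →L[ℝ] E) =
      mfderiv I I (fun k : G => g * k * g⁻¹) b := by rintro _ _ rfl; rfl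
  refine this.trans ?_
  exact congrArg (fun T : E →L[ℝ] E => T ∘L (Ad I h : E →L[ℝ] E)) (h2 (h * 1 * h⁻¹) 1 (by simp))

variable (I) in
/-- The adjoint representation as a function to a fixed normed space: the Lie algebra `𝔤` is by
definition the model space `E`. -/
def AdModel (g : G) : E →L[ℝ] E := Ad I g

/-- The adjoint representation is smooth. -/
theorem contMDiff_Ad : ContMDiff I 𝓘(ℝ, E →L[ℝ] E) ∞ (AdModel I : G → E →L[ℝ] E) := by
  intro g
  have h := ContMDiffAt.mfderiv (I := I) (I' := I) (x₀ := g) (n := ∞) (m := ∞) (J := I)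
    (fun g h : G => g * h * g⁻¹) (fun _ => 1)
    (((contMDiff_fst.mul contMDiff_snd).mul (contMDiff_fst.inv)).contMDiffAt) contMDiffAt_const (by simp)
  have h2 : (fun g : G => g * 1 * g⁻¹) = fun _ => (1 : G) := by ext; simp
  rw [h2] at h
  refine h.congr_of_eventuallyEq (Filter.Eventually.of_forall fun x => ?_)
  have e0 := inTangentCoordinates_eq (I := I) (I' := I) (fun _ : G => (1 : G)) (fun _ : G => (1 : G))
    (AdModel I) (x := x) (x₀ := g) (hx := mem_chart_source H (1 : G)) (hy := mem_chart_source H (1 : G))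
  refine Eq.trans ?_ e0.symm
  ext v
  have e1 : ∀ w, (tangentBundleCore I G).coordChange (achart H (1:G)) (achart H (1:G)) 1 w = w :=
    fun w => (tangentBundleCore I G).coordChange_self _ _ (mem_chart_source H (1:G)) w
  simp only [ContinuousLinearMap.comp_apply, e1]

variable [CompleteSpace E]

theorem Ad_inv_comp (g : G) : Ad I g⁻¹ ∘L Ad I g = ContinuousLinearMap.id ℝ _ := by
  rw [← Ad_mul, inv_mul_cancel, Ad_one]

theorem Ad_lie (g : G) (v w : GroupLieAlgebra I G) : Ad I g ⁅v, w⁆ = ⁅Ad I g v, Ad I g w⁆ := by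
  set f : G → G := fun h => g * h * g⁻¹ with hf
  have hd (k : G) : MDifferentiableAt I I f k := mdifferentiableAt_conj g k
  have hl (k l : G) : MDifferentiableAt I I (fun m => k * m) l :=
    (contMDiff_mul_left (I := I) (n := ∞)).mdifferentiableAt (by simp)
  have hinv (h : G) : (mfderiv I I f h).IsInvertible := by
    let Φ : G ≃ₘ^∞⟮I, I⟯ G :=
      { toFun := f
        invFun := fun h => g⁻¹ * h * g⁻¹⁻¹
        left_inv := fun h => by simp [f, mul_assoc]
        right_inv := fun h => by simp [f, mul_assoc]
        contMDiff_toFun := contMDiff_conj g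
        contMDiff_invFun := contMDiff_conj g⁻¹ }
    exact ⟨Φ.mfderivToContinuousLinearEquiv (by simp) h, rfl⟩
  have h1 : f 1 = 1 := by simp [f]
  have key (u : GroupLieAlgebra I G) :
      mpullback I I f (mulInvariantVectorField (Ad I g u)) = mulInvariantVectorField u := by
    ext h
    rw [mpullback]
    have hc : mulInvariantVectorField (Ad I g u) (f h) =
        mfderiv I I f h (mulInvariantVectorField u h) := by
      have e : (fun m => f h * m) ∘ f = f ∘ (fun m => h * m) := by
        ext m; simp [f, mul_assoc]
      have c1 := mfderiv_comp_of_eq (x := (1 : G)) (hl (f h) 1) (hd 1) h1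
      have c2 := mfderiv_comp_of_eq (x := (1 : G)) (hd h) (hl h 1) (mul_one h)
      have b1 : ∀ a : G, a = 1 → ∀ x : E, (mfderiv I I (fun m => f h * m) a : E →L[ℝ] E) x =
          (mfderiv I I (fun m => f h * m) 1 : E →L[ℝ] E) x := by rintro _ rfl _; rfl
      have b2 : ∀ a : G, a = h → ∀ x : E, (mfderiv I I f a : E →L[ℝ] E) x =
          (mfderiv I I f h : E →L[ℝ] E) x := by rintro _ rfl _; rfl
      rw [e] at c1
      have c3 := c1.symm.trans c2
      have c4 := congrArg (fun T : E →L[ℝ] E => T u) c3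
      exact (b1 _ h1 _).symm.trans (c4.trans (b2 _ (mul_one h) _))
    rw [hc]
    exact (hinv h).inverse_apply_self _
  have hv := mdifferentiableAt_mulInvariantVectorField (I := I) (Ad I g v) (g := f 1)
  have hw := mdifferentiableAt_mulInvariantVectorField (I := I) (Ad I g w) (g := f 1)
  have := mpullback_mlieBracket (n := ∞) (f := f) (x₀ := 1) hv hw (contMDiff_conj g).contMDiffAt (by simp only [minSmoothness_of_isRCLikeNormedField]; exact ENat.LEInfty.out)
  rw [key, key, mpullback] at this
  rw [GroupLieAlgebra.bracket_def, GroupLieAlgebra.bracket_def, ← this]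
  have b3 : ∀ a : G, a = 1 → (mlieBracket I (mulInvariantVectorField (Ad I g v))
      (mulInvariantVectorField (Ad I g w)) a : E) = mlieBracket I (mulInvariantVectorField (Ad I g v))
      (mulInvariantVectorField (Ad I g w)) (1 : G) := by rintro _ rfl; rfl
  exact ((hinv 1).self_apply_inverse _).trans (b3 _ h1)

variable (I) in
/-- `Ad g` is an automorphism of the Lie algebra. -/
def AdEquiv (g : G) : GroupLieAlgebra I G ≃ₗ⁅ℝ⁆ GroupLieAlgebra I G where
  toFun := Ad I g
  map_add' := map_add _
  map_smul' := map_smul _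
  map_lie' := Ad_lie g _ _
  invFun := Ad I g⁻¹
  left_inv v := by
    have := congrArg (fun T : E →L[ℝ] E => T v) (Ad_inv_comp (I := I) g); simpa using! this
  right_inv v := by
    have := congrArg (fun T : E →L[ℝ] E => T v) (Ad_inv_comp (I := I) g⁻¹); simpa using! this

/-- The Killing form is invariant under the adjoint representation. -/
theorem killingForm_Ad (g : G) (v w : GroupLieAlgebra I G) :
    killingForm ℝ (GroupLieAlgebra I G) (Ad I g v) (Ad I g w) = killingForm ℝ _ v w :=
  LieAlgebra.killingForm_of_equiv_apply (AdEquiv I g) v w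
end Adjoint


section Principal
open scoped RightActions
open Set

variable {EG : Type*} [NormedAddCommGroup EG] [NormedSpace ℝ EG]
  {HG : Type*} [TopologicalSpace HG] (IG : ModelWithCorners ℝ EG HG)
  {EM : Type*} [NormedAddCommGroup EM] [NormedSpace ℝ EM]
  {HM : Type*} [TopologicalSpace HM] (IM : ModelWithCorners ℝ EM HM)
  {EP : Type*} [NormedAddCommGroup EP] [NormedSpace ℝ EP]
  {HP : Type*} [TopologicalSpace HP] (IP : ModelWithCorners ℝ EP HP)
  (G : Type*) [TopologicalSpace G] [ChartedSpace HG G] [Group G]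
  (M : Type*) [TopologicalSpace M] [ChartedSpace HM M]
  (P : Type*) [TopologicalSpace P] [ChartedSpace HP P] [MulAction Gᵐᵒᵖ P]

/-- A smooth local trivialization `π⁻¹(U) ≃ U × G` of `π : P → M`, a diffeomorphism over `U` that is
equivariant for the right action of `G` on `P` and right multiplication on `G`. Here `p <• g` is
the right action `p · g`. -/
structure LocalTriv (proj : P → M) extends OpenPartialHomeomorph P (M × G) where
  baseSet : Set M
  open_baseSet : IsOpen baseSet
  source_eq : source = proj ⁻¹' baseSet
  target_eq : target = baseSet ×ˢ univ
  contMDiffOn_toFun : ContMDiffOn IP (IM.prod IG) ∞ toFun source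
  contMDiffOn_invFun : ContMDiffOn (IM.prod IG) IP ∞ invFun target
  fst_toFun : ∀ p ∈ source, (toFun p).1 = proj p
  equivariant : ∀ p ∈ source, ∀ g : G, toFun (p <• g) = ((toFun p).1, (toFun p).2 * g)

/-- The given right action of `G` on `P` is smooth and makes `π : P → M` a smooth principal
`G`-bundle. -/
structure PrincipalBundle where
  proj : P → M
  contMDiff_proj : ContMDiff IP IM ∞ proj
  contMDiff_act : ContMDiff (IP.prod IG) IP ∞ (fun q : P × G => q.1 <• q.2)
  proj_act : ∀ (p : P) (g : G), proj (p <• g) = proj p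
  exists_triv : ∀ x : M, ∃ t : LocalTriv IG IM IP G M P proj, x ∈ t.baseSet

namespace PrincipalBundle

variable {IG IM IP G M P} (B : PrincipalBundle IG IM IP G M P)

/-- The smooth local trivializations of the bundle. -/
abbrev Triv := LocalTriv IG IM IP G M P B.proj

/-- The fiber of `P` over `x`. -/
def Fiber (x : M) : Type _ := {p : P // B.proj p = x}

variable {B}

variable (B) in
/-- The point `p` as an element of the fiber over `π p`. -/
def fib (p : P) : B.Fiber (B.proj p) := ⟨p, rfl⟩

/-- The right action of `G` on a fiber of `P`. -/
def Fiber.act {x : M} (p : B.Fiber x) (g : G) : B.Fiber x := ⟨p.1 <• g, (B.proj_act _ _).trans p.2⟩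

theorem Fiber.act_one {x : M} (p : B.Fiber x) : p.act (1 : G) = p := Subtype.ext (one_smul _ p.1)

theorem Fiber.act_mul {x : M} (p : B.Fiber x) (g h : G) : p.act (g * h) = (p.act g).act h :=
  Subtype.ext (by simp [Fiber.act, mul_smul])

theorem triv_source (t : B.Triv) {p : P} (hp : B.proj p ∈ t.baseSet) :
    p ∈ t.source := by rw [t.source_eq]; exact hp

theorem triv_target (t : B.Triv) {x : M} (hx : x ∈ t.baseSet) (g : G) :
    (x, g) ∈ t.target := by rw [t.target_eq]; exact ⟨hx, mem_univ _⟩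

theorem proj_triv_symm (t : B.Triv) {x : M} (hx : x ∈ t.baseSet) (g : G) :
    B.proj (t.toOpenPartialHomeomorph.symm (x, g)) = x := by
  have h := t.toOpenPartialHomeomorph.right_inv (triv_target t hx g)
  have h2 := t.fst_toFun _ (t.toOpenPartialHomeomorph.map_target (triv_target t hx g))
  exact h2.symm.trans (congrArg Prod.fst h)

theorem triv_act (t : B.Triv) {p : P} (hp : B.proj p ∈ t.baseSet) (g : G) :
    t.toOpenPartialHomeomorph (p <• g) = (B.proj p, (t.toOpenPartialHomeomorph p).2 * g) := by
  have h := t.equivariant p (triv_source t hp) g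
  rw [← t.fst_toFun p (triv_source t hp)]
  exact h

theorem triv_apply (t : B.Triv) {p : P} (hp : B.proj p ∈ t.baseSet) :
    t.toOpenPartialHomeomorph p = (B.proj p, (t.toOpenPartialHomeomorph p).2) := by
  rw [← t.fst_toFun p (triv_source t hp)]
  rfl

theorem Fiber.exists_act {x : M} (p q : B.Fiber x) : ∃ g : G, q = p.act g := by
  obtain ⟨t, ht⟩ := B.exists_triv x
  have hp : B.proj p.1 ∈ t.baseSet := by rw [p.2]; exact ht
  have hq : B.proj q.1 ∈ t.baseSet := by rw [q.2]; exact ht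
  refine ⟨(t.toOpenPartialHomeomorph p.1).2⁻¹ * (t.toOpenPartialHomeomorph q.1).2, Subtype.ext ?_⟩
  have hpg : B.proj (p.act ((t.toOpenPartialHomeomorph p.1).2⁻¹ *
      (t.toOpenPartialHomeomorph q.1).2)).1 ∈ t.baseSet := by rw [(p.act _).2]; exact ht
  refine t.toOpenPartialHomeomorph.injOn (triv_source t hq) (triv_source t hpg) ?_
  rw [Fiber.act, triv_act t hp, triv_apply t hq, p.2, q.2]
  simp

theorem Fiber.act_inj {x : M} (p : B.Fiber x) {g h : G} (H : p.act g = p.act h) : g = h := by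
  obtain ⟨t, ht⟩ := B.exists_triv x
  have hp : B.proj p.1 ∈ t.baseSet := by rw [p.2]; exact ht
  have h1 := congrArg (fun q : B.Fiber x => (t.toOpenPartialHomeomorph q.1).2) H
  simpa [Fiber.act, triv_act t hp] using h1

instance (x : M) : Nonempty (B.Fiber x) := by
  obtain ⟨t, ht⟩ := B.exists_triv x
  exact ⟨⟨_, proj_triv_symm t ht 1⟩⟩

variable [LieGroup IG ∞ G]

theorem Ad_inv_self (g : G) (ξ : GroupLieAlgebra IG G) : Ad IG g⁻¹ (Ad IG g ξ) = ξ := by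
  rw [← ContinuousLinearMap.comp_apply, ← Ad_mul, inv_mul_cancel, Ad_one]; rfl

theorem Ad_self_inv (g : G) (ξ : GroupLieAlgebra IG G) : Ad IG g (Ad IG g⁻¹ ξ) = ξ := by
  rw [← ContinuousLinearMap.comp_apply, ← Ad_mul, mul_inv_cancel, Ad_one]; rfl

variable (B)

/-- The relation `(p, ξ) ∼ (p · g, Ad g⁻¹ ξ)` on `P_x × 𝔤`. -/
def adjointSetoid (x : M) : Setoid (B.Fiber x × GroupLieAlgebra IG G) where
  r a b := ∃ g : G, b = (a.1.act g, Ad IG g⁻¹ a.2)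
  iseqv :=
    { refl := fun a => ⟨1, by simp [Fiber.act_one, Ad_one]⟩
      symm := by
        rintro a _ ⟨g, rfl⟩
        refine ⟨g⁻¹, Prod.ext ?_ ?_⟩
        · simp [← Fiber.act_mul, Fiber.act_one]
        · exact (congrArg (fun k => Ad IG k (Ad IG g⁻¹ a.2)) (inv_inv g)).trans
            (Ad_self_inv g a.2) |>.symm
      trans := by
        rintro a _ _ ⟨g, rfl⟩ ⟨h, rfl⟩
        refine ⟨g * h, Prod.ext ?_ ?_⟩
        · simp [← Fiber.act_mul]
        · simp [mul_inv_rev, Ad_mul] }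

/-- The fiber `(P_x × 𝔤) / G` over `x` of the adjoint bundle. -/
def AdjointFiber (x : M) : Type _ := Quotient (B.adjointSetoid x)

variable {B}

/-- The class `[p, ξ]` in the adjoint bundle. -/
def cls {x : M} (p : B.Fiber x) (ξ : GroupLieAlgebra IG G) : B.AdjointFiber x :=
  Quotient.mk (B.adjointSetoid x) (p, ξ)

theorem cls_act {x : M} (p : B.Fiber x) (g : G) (ξ : GroupLieAlgebra IG G) :
    cls (p.act g) ξ = cls p (Ad IG g ξ) := by
  refine (Quotient.sound ⟨g, ?_⟩ : cls p (Ad IG g ξ) = _).symm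
  rw [Ad_inv_self]

theorem cls_bijective {x : M} (p : B.Fiber x) : Function.Bijective (cls (B := B) p) := by
  constructor
  · intro ξ ζ h
    obtain ⟨g, hg⟩ := Quotient.exact h
    have h1 := congrArg Prod.fst hg
    have h2 := congrArg Prod.snd hg
    have h3 : (1 : G) = g := p.act_inj (by rw [Fiber.act_one]; exact h1)
    subst h3
    simpa [Ad_one] using h2.symm
  · intro η
    obtain ⟨⟨q, ζ⟩, rfl⟩ := Quotient.exists_rep η
    obtain ⟨g, rfl⟩ := p.exists_act q
    exact ⟨_, (cls_act p g ζ).symm⟩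

/-- A point `p` in the fiber of `P` over `x` identifies the fiber of the adjoint bundle
with `𝔤`, via `ξ ↦ [p, ξ]`. -/
def clsEquiv {x : M} (p : B.Fiber x) : GroupLieAlgebra IG G ≃ B.AdjointFiber x :=
  Equiv.ofBijective _ (cls_bijective p)

/-- An auxiliary point in the fiber over `x`. -/
def pt (x : M) : B.Fiber x := Classical.choice inferInstance

/-! The vector space structure on the fibers for which all the bijections `ξ ↦ [p, ξ]` are
linear homeomorphisms, see `clsL`. -/

instance (x : M) : AddCommGroup (B.AdjointFiber x) := (clsEquiv (pt x)).symm.addCommGroup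
instance (x : M) : Module ℝ (B.AdjointFiber x) := (clsEquiv (pt x)).symm.module ℝ
instance (x : M) : TopologicalSpace (B.AdjointFiber x) := (clsEquiv (pt x)).symm.topologicalSpace

/-- `ξ ↦ [p, ξ]` for the auxiliary point. -/
def clsL₀ (x : M) : GroupLieAlgebra IG G ≃L[ℝ] B.AdjointFiber x :=
  ((clsEquiv (pt x)).symm.continuousLinearEquiv ℝ).symm

theorem clsL₀_apply (x : M) (ξ : GroupLieAlgebra IG G) :
    clsL₀ (B := B) x ξ = cls (pt x) ξ := rfl

/-- The adjoint representation by invertible maps. -/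
def AdL (g : G) : GroupLieAlgebra IG G ≃L[ℝ] GroupLieAlgebra IG G :=
  ContinuousLinearEquiv.equivOfInverse (Ad IG g) (Ad IG g⁻¹) (Ad_inv_self g) (Ad_self_inv g)

/-- The linear homeomorphism `ξ ↦ [p, ξ]` from `𝔤` to the fiber of the adjoint bundle. -/
def clsL {x : M} (p : B.Fiber x) : GroupLieAlgebra IG G ≃L[ℝ] B.AdjointFiber x :=
  (AdL (((pt x).exists_act p).choose)).trans (clsL₀ x)

theorem clsL_apply {x : M} (p : B.Fiber x) (ξ : GroupLieAlgebra IG G) :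
    clsL p ξ = cls p ξ := by
  have h := ((pt x).exists_act p).choose_spec
  conv_rhs => rw [h, cls_act]
  rfl

theorem clsL_act {x : M} (p : B.Fiber x) (g : G) (ξ : GroupLieAlgebra IG G) :
    clsL (p.act g) ξ = clsL p (Ad IG g ξ) := by
  rw [clsL_apply, clsL_apply, cls_act]

theorem clsL_symm_act {x : M} (p : B.Fiber x) (g : G) (η : B.AdjointFiber x) :
    (clsL p).symm η = Ad IG g ((clsL (p.act g)).symm η) := by
  rw [ContinuousLinearEquiv.symm_apply_eq, ← clsL_act, ContinuousLinearEquiv.apply_symm_apply]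

instance (x : M) : IsTopologicalAddGroup (B.AdjointFiber x) :=
  (clsL₀ (B := B) x).symm.toHomeomorph.isInducing.topologicalAddGroup (clsL₀ (B := B) x).symm
instance (x : M) : ContinuousSMul ℝ (B.AdjointFiber x) :=
  (clsL₀ (B := B) x).symm.continuousSMul
instance (x : M) : T2Space (B.AdjointFiber x) := by
  have : T2Space (GroupLieAlgebra IG G) := inferInstanceAs (T2Space EG)
  exact (clsL₀ (B := B) x).toHomeomorph.t2Space
instance [FiniteDimensional ℝ EG] (x : M) : FiniteDimensional ℝ (B.AdjointFiber x) := by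
  have : FiniteDimensional ℝ (GroupLieAlgebra IG G) := inferInstanceAs (FiniteDimensional ℝ EG)
  exact (clsL₀ (B := B) x).toLinearEquiv.finiteDimensional

/-- The point `t⁻¹(x, 1)` in the fiber over `x`, for `x` in the base set of `t`. -/
def framePt (t : B.Triv) (x : M) : B.Fiber x :=
  open Classical in
  if hx : x ∈ t.baseSet then
    (⟨t.toOpenPartialHomeomorph.symm (x, 1), proj_triv_symm t hx 1⟩ : B.Fiber x)
  else pt x

theorem framePt_val (t : B.Triv) {x : M} (hx : x ∈ t.baseSet) :
    (framePt t x).1 = t.toOpenPartialHomeomorph.symm (x, 1) := by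
  unfold framePt
  exact congrArg Subtype.val (dif_pos hx)

/-- A point of `P` is obtained from the section `t⁻¹(·, 1)` by acting with its second
coordinate in the trivialization. -/
theorem framePt_act (t : B.Triv) {x : M} (hx : x ∈ t.baseSet) (p : B.Fiber x) :
    (framePt t x).act (t.toOpenPartialHomeomorph p.1).2 = p := by
  have hp : B.proj p.1 ∈ t.baseSet := by rw [p.2]; exact hx
  have hf : B.proj (framePt t x).1 ∈ t.baseSet := by rw [(framePt t x).2]; exact hx
  have hfg := ((framePt t x).act (t.toOpenPartialHomeomorph p.1).2).2
  refine Subtype.ext (t.toOpenPartialHomeomorph.injOn (triv_source t (by rw [hfg]; exact hx))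
    (triv_source t hp) ?_)
  rw [Fiber.act, triv_act t hf, triv_apply t hp, p.2, (framePt t x).2, framePt_val t hx,
    t.toOpenPartialHomeomorph.right_inv (triv_target t hx 1), one_mul]

/-- The local trivialization `[p, ξ] ↦ (x, Ad g ξ)` of the adjoint bundle, where `t p = (x, g)`,
induced by a local trivialization `t` of the principal bundle. -/
def pretriv (t : B.Triv) : Pretrivialization EG (π EG B.AdjointFiber) where
  toFun z := (z.1, (clsL (framePt t z.1)).symm z.2)
  invFun y := ⟨y.1, clsL (framePt t y.1) y.2⟩
  source := π EG B.AdjointFiber ⁻¹' t.baseSet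
  target := t.baseSet ×ˢ univ
  map_source' _ hz := ⟨hz, mem_univ _⟩
  map_target' _ hy := hy.1
  left_inv' z _ := by
    obtain ⟨x, η⟩ := z
    exact congrArg (TotalSpace.mk x) ((clsL (framePt t x)).apply_symm_apply η)
  right_inv' y _ := Prod.ext rfl ((clsL (framePt t y.1)).symm_apply_apply y.2)
  open_target := t.open_baseSet.prod isOpen_univ
  baseSet := t.baseSet
  open_baseSet := t.open_baseSet
  source_eq := rfl
  target_eq := rfl
  proj_toFun _ _ := rfl

theorem pretriv_apply (t : B.Triv) (x : M) (η : B.AdjointFiber x) :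
    (pretriv t ⟨x, η⟩).2 = (clsL (framePt t x)).symm η := rfl

instance (t : B.Triv) : (pretriv t).IsLinear ℝ where
  linear x _ := { map_add := fun η ζ => map_add (clsL (framePt t x)).symm η ζ
                  map_smul := fun c η => map_smul (clsL (framePt t x)).symm c η }

theorem pretriv_symm (t : B.Triv) {x : M} (hx : x ∈ t.baseSet) (v : EG) :
    (pretriv t).symm x v = clsL (framePt t x) v := by
  have h := (pretriv t).symm_apply_apply_mk hx (clsL (framePt t x) v)
  rw [pretriv_apply] at h
  refine Eq.trans ?_ h
  exact congrArg _ ((clsL (framePt t x)).symm_apply_apply v).symm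

/-- The transition function between the trivializations induced by `t` and `t'`. -/
def transition (t t' : B.Triv) (x : M) : EG →L[ℝ] EG :=
  AdModel IG (t'.toOpenPartialHomeomorph (t.toOpenPartialHomeomorph.symm (x, 1))).2

theorem transition_apply (t t' : B.Triv) {x : M} (hx : x ∈ t.baseSet) (hx' : x ∈ t'.baseSet)
    (v : EG) : transition t t' x v = (pretriv t' ⟨x, (pretriv t).symm x v⟩).2 := by
  rw [pretriv_symm t hx, pretriv_apply, clsL_symm_act (framePt t' x)
    (t'.toOpenPartialHomeomorph (framePt t x).1).2, framePt_act t' hx' (framePt t x),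
    (clsL (framePt t x)).symm_apply_apply v, framePt_val t hx]
  rfl

theorem contMDiffOn_transition (t t' : B.Triv) :
    ContMDiffOn IM 𝓘(ℝ, EG →L[ℝ] EG) ∞ (transition t t') (t.baseSet ∩ t'.baseSet) := by
  have h1 : ContMDiffOn IM (IM.prod IG) ∞ (fun x : M => (x, (1 : G))) (t.baseSet ∩ t'.baseSet) :=
    contMDiffOn_id.prodMk contMDiffOn_const
  have h2 := t.contMDiffOn_invFun.comp h1 (fun x hx => triv_target t hx.1 1)
  have h3 := t'.contMDiffOn_toFun.comp h2 (fun x hx => triv_source t' (by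
    exact (proj_triv_symm t hx.1 1).symm ▸ hx.2))
  exact (contMDiff_Ad (I := IG) (G := G)).comp_contMDiffOn (contMDiff_snd.comp_contMDiffOn h3)

/-- The induced local trivializations of the adjoint bundle are smoothly compatible. -/
def adjointPrebundle : VectorPrebundle ℝ EG B.AdjointFiber where
  pretrivializationAtlas := range pretriv
  pretrivialization_linear' := by rintro _ ⟨t, rfl⟩; infer_instance
  pretrivializationAt x := pretriv (B.exists_triv x).choose
  mem_base_pretrivializationAt x := (B.exists_triv x).choose_spec
  pretrivialization_mem_atlas x := mem_range_self _
  exists_coordChange := by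
    rintro _ ⟨t, rfl⟩ _ ⟨t', rfl⟩
    exact ⟨transition t t', (contMDiffOn_transition t t').continuousOn,
      fun x hx v => transition_apply t t' hx.1 hx.2 v⟩
  totalSpaceMk_isInducing x := by
    have h := (clsL (framePt (B.exists_triv x).choose x)).symm.toHomeomorph.isInducing
    exact Topology.isInducing_const_prod.2 h

instance : (adjointPrebundle (B := B)).IsContMDiff IM ∞ where
  exists_contMDiffCoordChange := by
    rintro _ ⟨t, rfl⟩ _ ⟨t', rfl⟩
    exact ⟨transition t t', contMDiffOn_transition t t',
      fun x hx v => transition_apply t t' hx.1 hx.2 v⟩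

/-! The adjoint bundle as a smooth vector bundle. -/

instance : TopologicalSpace (TotalSpace EG B.AdjointFiber) := adjointPrebundle.totalSpaceTopology
instance : FiberBundle EG B.AdjointFiber := adjointPrebundle.toFiberBundle
instance : VectorBundle ℝ EG B.AdjointFiber := adjointPrebundle.toVectorBundle
instance : ContMDiffVectorBundle ∞ EG B.AdjointFiber IM :=
  adjointPrebundle.contMDiffVectorBundle IM
instance : ContMDiffVectorBundle 1 EG B.AdjointFiber IM :=
  ContMDiffVectorBundle.of_le (n := ∞) (by simp)

variable (B) in
/-- The function `P → 𝔤` corresponding to a section of the adjoint bundle,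
`σ (π p) = [p, lift σ p]`. -/
def lift (σ : Π x, B.AdjointFiber x) (p : P) : EG :=
  (clsL (B.fib p)).symm (σ (B.proj p))

theorem lift_eq (t : B.Triv) (σ : Π x, B.AdjointFiber x) {p : P} (hp : B.proj p ∈ t.baseSet) :
    B.lift σ p = AdModel IG (t.toOpenPartialHomeomorph p).2⁻¹ (pretriv t ⟨B.proj p, σ (B.proj p)⟩).2 := by
  have h := clsL_symm_act (framePt t (B.proj p)) (t.toOpenPartialHomeomorph p).2 (σ (B.proj p))
  have h2 := framePt_act t hp (B.fib p)
  rw [pretriv_apply, h]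
  refine (Ad_inv_self (IG := IG) (t.toOpenPartialHomeomorph p).2 _).symm.trans ?_
  have h3 : ∀ q : B.Fiber (B.proj p), q = B.fib p → (clsL q).symm (σ (B.proj p)) = B.lift σ p := by
    rintro _ rfl; rfl
  refine congrArg (fun z => Ad IG (t.toOpenPartialHomeomorph p).2⁻¹
    (Ad IG (t.toOpenPartialHomeomorph p).2 z)) (h3 _ h2).symm

/-! ### Derivatives along the bundle -/

theorem mdiff_proj (B : PrincipalBundle IG IM IP G M P) (p : P) : MDifferentiableAt IP IM B.proj p :=
  B.contMDiff_proj.mdifferentiableAt (by simp)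

theorem mdiff_orbit (B : PrincipalBundle IG IM IP G M P) (p : P) (g : G) :
    MDifferentiableAt IG IP (fun h : G => p <• h) g :=
  (B.contMDiff_act.comp (contMDiff_const.prodMk contMDiff_id)).mdifferentiableAt (by simp)

theorem mdiff_triv (t : B.Triv) {p : P} (hp : B.proj p ∈ t.baseSet) :
    MDifferentiableAt IP (IM.prod IG) t.toOpenPartialHomeomorph p :=
  (t.contMDiffOn_toFun.contMDiffAt (t.open_source.mem_nhds (triv_source t hp))).mdifferentiableAt
    (by simp)

theorem mdiff_triv_symm (t : B.Triv) {x : M} (hx : x ∈ t.baseSet) (g : G) :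
    MDifferentiableAt (IM.prod IG) IP t.toOpenPartialHomeomorph.symm (x, g) :=
  (t.contMDiffOn_invFun.contMDiffAt (t.open_target.mem_nhds (triv_target t hx g))).mdifferentiableAt
    (by simp)

theorem triv_symm_eq (t : B.Triv) {p : P} (hp : B.proj p ∈ t.baseSet) (h : G) :
    t.toOpenPartialHomeomorph.symm (B.proj p, h) =
      p <• ((t.toOpenPartialHomeomorph p).2⁻¹ * h) := by
  have hph : B.proj (p <• ((t.toOpenPartialHomeomorph p).2⁻¹ * h)) ∈ t.baseSet := by
    rw [B.proj_act]; exact hp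
  refine t.toOpenPartialHomeomorph.injOn
    (t.toOpenPartialHomeomorph.map_target (triv_target t hp h)) (triv_source t hph) ?_
  rw [t.toOpenPartialHomeomorph.right_inv (triv_target t hp h), triv_act t hp]
  simp

/-- A local section through `p` has derivative right inverse to the derivative of `π`. -/
theorem exists_section (p : P) : ∃ ds : EM →L[ℝ] EP, ∀ v,
    (mfderiv IP IM B.proj p : EP →L[ℝ] EM) (ds v) = v := by
  obtain ⟨t, ht⟩ := B.exists_triv (B.proj p)
  set s : M → P := fun x => t.toOpenPartialHomeomorph.symm (x, (t.toOpenPartialHomeomorph p).2) with hs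
  have hsp : s (B.proj p) = p := by rw [hs]; simp [triv_symm_eq t ht]
  have hds : MDifferentiableAt IM IP s (B.proj p) :=
    (mdiff_triv_symm t ht _).comp (B.proj p) (mdifferentiableAt_id.prodMk mdifferentiableAt_const)
  refine ⟨mfderiv IM IP s (B.proj p), fun v => ?_⟩
  have h1 := mfderiv_comp_of_eq (mdiff_proj B p) hds hsp
  have h2 : B.proj ∘ s =ᶠ[𝓝 (B.proj p)] id := by
    filter_upwards [t.open_baseSet.mem_nhds ht] with x hx
    exact proj_triv_symm t hx _
  have h3 := h2.mfderiv_eq (I := IM) (I' := IM)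
  have h4 : ∀ y, (mfderiv IM IM (B.proj ∘ s) (B.proj p) : EM →L[ℝ] EM) y = y := fun y => by
    exact congrArg (fun T : EM →L[ℝ] EM => T y) (h3.trans mfderiv_id)
  have h5 : ∀ q : P, q = p → ∀ w : EP, (mfderiv IP IM B.proj q : EP →L[ℝ] EM) w =
    (mfderiv IP IM B.proj p : EP →L[ℝ] EM) w := by rintro _ rfl _; rfl
  refine Eq.trans ?_ (h4 v)
  exact (h5 _ hsp _).symm.trans (congrArg (fun T : EM →L[ℝ] EM => T v) h1).symm

theorem mfderiv_proj_orbit (p : P) (ζ : EG) : (mfderiv IP IM B.proj p : EP →L[ℝ] EM)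
    ((mfderiv IG IP (fun g : G => p <• g) 1 : EG →L[ℝ] EP) ζ) = 0 := by
  have h1 := mfderiv_comp_of_eq (x := (1 : G)) (mdiff_proj B p) (mdiff_orbit B p 1) (one_smul Gᵐᵒᵖ p)
  have h2 : B.proj ∘ (fun g : G => p <• g) = fun _ => B.proj p := by ext g; exact B.proj_act p g
  rw [h2] at h1
  have h5 : ∀ q : P, q = p → ∀ w : EP, (mfderiv IP IM B.proj q : EP →L[ℝ] EM) w =
    (mfderiv IP IM B.proj p : EP →L[ℝ] EM) w := by rintro _ rfl _; rfl
  refine (h5 _ (one_smul Gᵐᵒᵖ p) _).symm.trans ?_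
  refine (congrArg (fun T : EG →L[ℝ] EM => T ζ) h1).symm.trans ?_
  exact congrArg (fun T : EG →L[ℝ] EM => T ζ) (mfderiv_const (I := IG) (I' := IM))

/-- Vertical vectors are the values of the infinitesimal action. -/
theorem exists_fundamental (p : P) (w : EP) (hw : (mfderiv IP IM B.proj p : EP →L[ℝ] EM) w = 0) :
    ∃ ζ : EG, w = (mfderiv IG IP (fun g : G => p <• g) 1 : EG →L[ℝ] EP) ζ := by
  obtain ⟨t, ht⟩ := B.exists_triv (B.proj p)
  set τ := t.toOpenPartialHomeomorph with hτ
  set k : G := (τ p).2 with hk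
  have hτp : τ p = (B.proj p, k) := triv_apply t ht
  -- the derivative of `τ` on `w`
  set T : EP →L[ℝ] EM × EG := mfderiv IP (IM.prod IG) τ p with hT
  have hT1 : (T w).1 = 0 := by
    have h1 := mfderiv_comp p (mdifferentiableAt_fst (I := IM) (I' := IG) (x := τ p)) (mdiff_triv t ht)
    have h2 : (Prod.fst ∘ τ) =ᶠ[𝓝 p] B.proj := by
      filter_upwards [t.open_source.mem_nhds (triv_source t ht)] with q hq
      exact t.fst_toFun q hq
    have h3 := h2.mfderiv_eq (I := IP) (I' := IM)
    rw [mfderiv_fst] at h1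
    have h4 := congrArg (fun T : EP →L[ℝ] EM => T w) (h3.symm.trans h1)
    exact h4.symm.trans hw
  have hid := mfderiv_comp p (mdiff_triv_symm t ht k |> fun h => (show
    MDifferentiableAt (IM.prod IG) IP τ.symm (τ p) by rw [hτp]; exact h)) (mdiff_triv t ht)
  have hid2 : (τ.symm ∘ τ) =ᶠ[𝓝 p] id := by
    filter_upwards [t.open_source.mem_nhds (triv_source t ht)] with q hq
    exact τ.left_inv hq
  have hid3 : (mfderiv (IM.prod IG) IP τ.symm (τ p) : EM × EG →L[ℝ] EP) (T w) = w :=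
    (congrArg (fun T : EP →L[ℝ] EP => T w) hid).symm.trans
      (congrArg (fun T : EP →L[ℝ] EP => T w) (hid2.mfderiv_eq.trans mfderiv_id))
  have hTw : T w = (0, (T w).2) := Prod.ext hT1 rfl
  have b1 : ∀ y : M × G, y = (B.proj p, k) → (mfderiv (IM.prod IG) IP τ.symm y : EM × EG →L[ℝ] EP) =
    mfderiv (IM.prod IG) IP τ.symm (B.proj p, k) := by rintro _ rfl; rfl
  -- compare with the orbit map
  have e : (fun h : G => τ.symm (B.proj p, h)) = (fun g : G => p <• g) ∘ (fun h => k⁻¹ * h) := by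
    ext h; exact triv_symm_eq t ht h
  have hl : MDifferentiableAt IG IG (fun h : G => k⁻¹ * h) k :=
    (contMDiff_mul_left (I := IG) (n := ∞)).mdifferentiableAt (by simp)
  have c1 := mfderiv_comp_of_eq (mdiff_orbit B p 1) hl (inv_mul_cancel k)
  have hj : HasMFDerivAt IG (IM.prod IG) (fun h : G => (B.proj p, h)) k
      (ContinuousLinearMap.inr ℝ EM EG) :=
    (hasMFDerivAt_const (B.proj p) k).prodMk (hasMFDerivAt_id k)
  have c2 := (HasMFDerivAt.comp k (mdiff_triv_symm t ht k).hasMFDerivAt hj).mfderiv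
  refine ⟨(mfderiv IG IG (fun h : G => k⁻¹ * h) k : EG →L[ℝ] EG) (T w).2, ?_⟩
  have b2 : ∀ y : G, y = 1 → ∀ z : EG, (mfderiv IG IP (fun g : G => p <• g) y : EG →L[ℝ] EP) z =
    (mfderiv IG IP (fun g : G => p <• g) 1 : EG →L[ℝ] EP) z := by rintro _ rfl _; rfl
  refine hid3.symm.trans ?_
  rw [b1 _ hτp, hTw]
  have c3 := (congrArg (fun f => (mfderiv IG IP f k : EG →L[ℝ] EP) (T w).2) e)
  refine (congrArg (fun S : EG →L[ℝ] EP => S (T w).2) c2).symm.trans (c3.trans ?_)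
  refine (congrArg (fun S : EG →L[ℝ] EP => S (T w).2) c1).trans ?_
  exact b2 _ (inv_mul_cancel k) _

theorem mdifferentiableAt_lift {σ : Π x, B.AdjointFiber x} {p : P}
    (hσ : DiffAt IM EG σ (B.proj p)) : MDifferentiableAt IP 𝓘(ℝ, EG) (B.lift σ) p := by
  set t : B.Triv := (B.exists_triv (B.proj p)).choose with ht
  have hp : B.proj p ∈ t.baseSet := (B.exists_triv (B.proj p)).choose_spec
  have h1 : MDifferentiableAt IM 𝓘(ℝ, EG) (fun x => (pretriv t ⟨x, σ x⟩).2) (B.proj p) :=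
    (mdifferentiableAt_section (IB := IM) (F := EG) σ).1 hσ
  have h2 := h1.comp p (mdiff_proj B p)
  have h3 : MDifferentiableAt IP 𝓘(ℝ, EG →L[ℝ] EG)
      (fun q => AdModel IG (t.toOpenPartialHomeomorph q).2⁻¹) p := by
    have h4 : MDifferentiableAt IP IG (fun q => (t.toOpenPartialHomeomorph q).2) p :=
      mdifferentiableAt_snd.comp p (mdiff_triv t hp)
    have h5 : MDifferentiableAt IG 𝓘(ℝ, EG →L[ℝ] EG) (fun g : G => AdModel IG g⁻¹)
        (t.toOpenPartialHomeomorph p).2 :=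
      ((contMDiff_Ad (I := IG) (G := G)).comp (contMDiff_inv IG ∞)).mdifferentiableAt (by simp)
    exact MDifferentiableAt.comp (f := fun q => (t.toOpenPartialHomeomorph q).2) p h5 h4
  refine (h3.clm_apply h2).congr_of_eventuallyEq ?_
  filter_upwards [t.open_source.mem_nhds (triv_source t hp)] with q hq
  exact lift_eq t σ (by rw [t.source_eq] at hq; exact hq)

end PrincipalBundle

variable {IG IM IP G M P} [LieGroup IG ∞ G]
section Connection
variable [IsManifold IP 1 P]

/-- A principal connection, given by its connection form `form`, a `𝔤`-valued 1-form on `P`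
that reproduces the generators of the infinitesimal action and is `Ad`-equivariant. -/
structure PrincipalConnection (B : PrincipalBundle IG IM IP G M P) where
  form : ∀ p : P, TangentSpace IP p →L[ℝ] GroupLieAlgebra IG G
  contMDiff_form :
    ContMDiff (M := TangentBundle IP P) (M' := EG) IP.tangent 𝓘(ℝ, EG) ∞ (fun w => form w.1 w.2)
  form_fundamental : ∀ (p : P) (ξ : GroupLieAlgebra IG G),
    form (p <• (1 : G)) (mfderiv IG IP (fun g : G => p <• g) 1 ξ) = ξ
  form_equivariant : ∀ (p : P) (g : G) (w : TangentSpace IP p),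
    form (p <• g) (mfderiv IP IP (fun q : P => q <• g) p w) = Ad IG g⁻¹ (form p w)

namespace PrincipalConnection
open PrincipalBundle

variable {B : PrincipalBundle IG IM IP G M P} (A : PrincipalConnection B)

/-- The isomorphism `w ↦ (dπ w, A w)` from `T_pP` to `T_{π p}M × 𝔤`. -/
def split (p : P) :
    TangentSpace IP p →L[ℝ] TangentSpace IM (B.proj p) × GroupLieAlgebra IG G :=
  (mfderiv IP IM B.proj p).prod (A.form p)

/-- The horizontal lift of tangent vectors of `M`: the horizontal lift of `v` to `p` is the
unique `w ∈ T_pP` with `dπ w = v` and `A w = 0`. -/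
def horLift (p : P) : TangentSpace IM (B.proj p) →L[ℝ] TangentSpace IP p :=
  (A.split p).inverse ∘L ContinuousLinearMap.inl ℝ (TangentSpace IM (B.proj p)) (GroupLieAlgebra IG G)

theorem form_orbit (p : P) (ζ : EG) : (A.form p : EP →L[ℝ] EG)
    ((mfderiv IG IP (fun g : G => p <• g) 1 : EG →L[ℝ] EP) ζ) = ζ := by
  have b : ∀ q : P, q = p → ∀ w : EP, (A.form q : EP →L[ℝ] EG) w = (A.form p : EP →L[ℝ] EG) w := by
    rintro _ rfl _; rfl
  exact (b _ (one_smul Gᵐᵒᵖ p) _).symm.trans (A.form_fundamental p ζ)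

theorem isInvertible_split (p : P) : (A.split p).IsInvertible := by
  obtain ⟨ds, hds⟩ := exists_section (B := B) p
  set dπ : EP →L[ℝ] EM := mfderiv IP IM B.proj p with hdπ
  set ωA : EP →L[ℝ] EG := A.form p with hωA
  set fu : EG →L[ℝ] EP := mfderiv IG IP (fun g : G => p <• g) 1 with hfu
  have F2 : ∀ ζ, dπ (fu ζ) = 0 := mfderiv_proj_orbit p
  have F3 : ∀ ζ, ωA (fu ζ) = ζ := A.form_orbit p
  have F4 : ∀ w, dπ w = 0 → ∃ ζ, w = fu ζ := exists_fundamental p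
  let S : EP →L[ℝ] EM × EG := dπ.prod ωA
  let R : EM × EG →L[ℝ] EP := ds ∘L ContinuousLinearMap.fst ℝ EM EG +
    fu ∘L (ContinuousLinearMap.snd ℝ EM EG - ωA ∘L ds ∘L ContinuousLinearMap.fst ℝ EM EG)
  have h1 : ∀ y, S (R y) = y := by
    rintro ⟨v, ζ⟩
    simp [S, R, F2, F3]
    exact hds v
  have h2 : ∀ w, R (S w) = w := fun w => by
    have h3 : S (R (S w) - w) = 0 := by rw [map_sub, h1, sub_self]
    obtain ⟨ζ, hζ⟩ := F4 (R (S w) - w) (congrArg Prod.fst h3)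
    have h4 : ωA (R (S w) - w) = 0 := congrArg Prod.snd h3
    rw [hζ, F3] at h4
    rw [h4, map_zero] at hζ
    exact sub_eq_zero.1 hζ
  have : S.IsInvertible := ContinuousLinearMap.IsInvertible.of_inverse (g := R)
    (ContinuousLinearMap.ext h1) (ContinuousLinearMap.ext h2)
  exact this

theorem split_horLift (p : P) (v : TangentSpace IM (B.proj p)) :
    A.split p (A.horLift p v) = (v, 0) :=
  (A.isInvertible_split p).self_apply_inverse _

/-- The horizontal lift projects back to the original vector. -/
theorem mfderiv_proj_horLift (p : P) (v : TangentSpace IM (B.proj p)) :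
    mfderiv IP IM B.proj p (A.horLift p v) = v :=
  congrArg Prod.fst (A.split_horLift p v)

/-- The horizontal lift is horizontal. -/
theorem form_horLift (p : P) (v : TangentSpace IM (B.proj p)) :
    A.form p (A.horLift p v) = 0 :=
  congrArg Prod.snd (A.split_horLift p v)

theorem eq_horLift (p : P) (v : TangentSpace IM (B.proj p)) (w : TangentSpace IP p)
    (h1 : mfderiv IP IM B.proj p w = v) (h2 : A.form p w = 0) : w = A.horLift p v := by
  have h : A.split p w = (v, 0) := Prod.ext h1 h2
  have h3 := (A.isInvertible_split p).inverse_apply_self w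
  rw [h] at h3
  exact h3.symm

/-- The covariant derivative of a section of the adjoint bundle, computed at a point `p` over
`π p`: if `σ (π q) = [q, s q]`, then `∇_v σ = [p, ds (horizontal lift of v to p)]`. -/
def covAt (σ : Π x, B.AdjointFiber x) (p : P) :
    TangentSpace IM (B.proj p) →L[ℝ] B.AdjointFiber (B.proj p) :=
  (clsL (B.fib p) :
    GroupLieAlgebra IG G →L[ℝ] B.AdjointFiber (B.proj p)) ∘L
  (mvfderiv IP (B.lift σ) p : TangentSpace IP p →L[ℝ] EG) ∘L A.horLift p

theorem covAt_apply (σ : Π x, B.AdjointFiber x) (p : P) (v : TangentSpace IM (B.proj p)) :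
    A.covAt σ p v = cls (B.fib p) (mvfderiv IP (B.lift σ) p (A.horLift p v)) :=
  clsL_apply _ _

/-- `covAt` at an auxiliary point over `x`. -/
def covFun (σ : Π x, B.AdjointFiber x) (x : M) : TangentSpace IM x →L[ℝ] B.AdjointFiber x :=
  Eq.rec (motive := fun y _ => TangentSpace IM y →L[ℝ] B.AdjointFiber y)
    (A.covAt σ (pt (B := B) x).1) (pt (B := B) x).2

theorem exists_covFun (x : M) : ∃ p : B.Fiber x, ∀ σ : Π x, B.AdjointFiber x,
    A.covFun σ x = Eq.rec (motive := fun y _ => TangentSpace IM y →L[ℝ] B.AdjointFiber y)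
    (A.covAt σ p.1) p.2 := ⟨pt x, fun _ => rfl⟩

/-- The linear connection on the adjoint bundle induced by a principal connection. -/
def cov : CovariantDerivative IM EG B.AdjointFiber where
  toFun := A.covFun
  isCovariantDerivativeOnUniv :=
    { add := fun {σ τ x} hσ hτ _ => by
        obtain ⟨⟨p, rfl⟩, hp⟩ := A.exists_covFun x
        rw [hp, hp, hp]
        have h := mvfderiv_add (mdifferentiableAt_lift hσ) (mdifferentiableAt_lift hτ)
        have h2 : B.lift (σ + τ) = B.lift σ + B.lift τ := by
          ext q; exact map_add (clsL (B.fib q)).symm _ _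
        ext v
        change clsL _ (mvfderiv IP (B.lift (σ + τ)) p (A.horLift p v)) = _
        rw [h2, h]
        exact map_add (clsL (B.fib p)) _ _
      leibniz := fun {σ f x} hσ hf _ => by
        obtain ⟨⟨p, rfl⟩, hp⟩ := A.exists_covFun x
        rw [hp, hp]
        have hfp : MDifferentiableAt IP 𝓘(ℝ, ℝ) (f ∘ B.proj) p := hf.comp p (mdiff_proj B p)
        have h := mvfderiv_smul hfp (mdifferentiableAt_lift hσ)
        have h2 : B.lift (f • σ) = (f ∘ B.proj) • B.lift σ := by
          ext q; exact map_smul (clsL (B.fib q)).symm _ _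
        have h3 (v : TangentSpace IM (B.proj p)) :
            mvfderiv IP (f ∘ B.proj) p (A.horLift p v) = mvfderiv IM f (B.proj p) v := by
          have h4 := mfderiv_comp p hf (mdiff_proj B p)
          have h5 := congrArg (fun T : EP →L[ℝ] ℝ => T (A.horLift p v)) h4
          refine h5.trans ?_
          exact congrArg (fun w : EM => (mfderiv IM 𝓘(ℝ, ℝ) f (B.proj p) : EM →L[ℝ] ℝ) w)
            (A.mfderiv_proj_horLift p v)
        have h6 : cls (B.fib p) (B.lift σ p) = σ (B.proj p) := by
          refine (clsL_apply _ _).symm.trans ?_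
          exact (clsL (B.fib p)).apply_symm_apply _
        ext v
        change clsL _ (mvfderiv IP (B.lift (f • σ)) p (A.horLift p v)) = _
        rw [h2, h]
        refine (congrArg (clsL (B.fib p))
          (show _ = f (B.proj p) • mvfderiv IP (B.lift σ) p (A.horLift p v) +
            mvfderiv IM f (B.proj p) v • B.lift σ p by rw [← h3]; rfl)).trans ?_
        refine (map_add (clsL (B.fib p)) _ _).trans ?_
        refine congrArg₂ (· + ·) (map_smul (clsL (B.fib p)) _ _) ?_
        refine (map_smul (clsL (B.fib p)) _ _).trans ?_
        exact congrArg (fun z => mvfderiv IM f (B.proj p) v • z) ((clsL_apply _ _).trans h6) }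

theorem mdiff_act (B : PrincipalBundle IG IM IP G M P) (g : G) (p : P) :
    MDifferentiableAt IP IP (fun q : P => q <• g) p :=
  (B.contMDiff_act.comp (contMDiff_id.prodMk contMDiff_const)).mdifferentiableAt (by simp)

theorem lift_act (σ : Π x, B.AdjointFiber x) (p : P) (g : G) :
    B.lift σ p = Ad IG g (B.lift σ (p <• g)) := by
  have h := clsL_symm_act (B.fib p) g (σ (B.proj p))
  refine h.trans (congrArg (Ad IG g) ?_)
  have h2 : ∀ (x : M) (q : B.Fiber x), (clsL q).symm (σ x) = B.lift σ q.1 := by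
    rintro _ ⟨q, rfl⟩; rfl
  exact h2 _ _

/-- Horizontal lifts are invariant under the action of `G`. -/
theorem horLift_act (p : P) (g : G) (v : EM) :
    (A.horLift (p <• g) : EM →L[ℝ] EP) v = (mfderiv IP IP (fun q : P => q <• g) p : EP →L[ℝ] EP)
      ((A.horLift p : EM →L[ℝ] EP) v) := by
  set w : EP := (A.horLift p : EM →L[ℝ] EP) v with hw
  refine (A.eq_horLift (p <• g) v ((mfderiv IP IP (fun q : P => q <• g) p : EP →L[ℝ] EP) w)
    ?_ ?_).symm
  · have h1 := mfderiv_comp p (mdiff_proj B (p <• g)) (mdiff_act B g p)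
    have h2 : B.proj ∘ (fun q : P => q <• g) = B.proj := by ext q; exact B.proj_act q g
    rw [h2] at h1
    exact (congrArg (fun T : EP →L[ℝ] EM => T w) h1).symm.trans (A.mfderiv_proj_horLift p v)
  · refine (A.form_equivariant p g w).trans ?_
    exact (congrArg (Ad IG g⁻¹) (A.form_horLift p v)).trans (map_zero _)

/-- The covariant derivative may be computed at any point of the fiber. -/
theorem cov_eq_covAt {σ : Π x, B.AdjointFiber x} {p : P} (hσ : DiffAt IM EG σ (B.proj p)) :
    A.cov σ (B.proj p) = A.covAt σ p := by
  obtain ⟨q, hq⟩ := A.exists_covFun (B.proj p)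
  obtain ⟨g, rfl⟩ := (B.fib p).exists_act q
  refine (hq σ).trans ?_
  have key : ∀ v : EM, mvfderiv IP (B.lift σ) p (A.horLift p v) =
      Ad IG g (mvfderiv IP (B.lift σ) (p <• g) (A.horLift (p <• g) v)) := fun v => by
    have h1 : B.lift σ = (AdModel IG g : EG → EG) ∘ (B.lift σ ∘ fun q : P => q <• g) := by
      ext q; exact lift_act σ q g
    have h0 : MDifferentiableAt IP 𝓘(ℝ, EG) (B.lift σ) (p <• g) :=
      mdifferentiableAt_lift ((B.proj_act p g).symm ▸ hσ)
    have h2 := mfderiv_comp p h0 (mdiff_act B g p)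
    have h3 : MDifferentiableAt 𝓘(ℝ, EG) 𝓘(ℝ, EG) (AdModel IG g : EG → EG)
      (B.lift σ (p <• g)) := (AdModel IG g).mdifferentiableAt
    have h4 := mfderiv_comp p h3 (h0.comp p (mdiff_act B g p))
    have h5 : (mfderiv 𝓘(ℝ, EG) 𝓘(ℝ, EG) (AdModel IG g : EG → EG) (B.lift σ (p <• g)) :
      EG →L[ℝ] EG) = AdModel IG g := (AdModel IG g).mfderiv_eq
    have h6 := congrArg (fun f => (mfderiv IP 𝓘(ℝ, EG) f p : EP →L[ℝ] EG) (A.horLift p v)) h1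
    refine h6.trans ((congrArg (fun T : EP →L[ℝ] EG => T (A.horLift p v)) h4).trans ?_)
    refine (congrArg (fun T : EG →L[ℝ] EG => T _) h5).trans ?_
    refine congrArg (AdModel IG g) ?_
    refine (congrArg (fun T : EP →L[ℝ] EG => T (A.horLift p v)) h2).trans ?_
    exact congrArg (mfderiv IP 𝓘(ℝ, EG) (B.lift σ) (p <• g) : EP →L[ℝ] EG)
      (A.horLift_act p g v).symm
  have h7 : ∀ (x : M) (h : B.proj (p <• g) = x) (v : EM),
      (Eq.rec (motive := fun y _ => TangentSpace IM y →L[ℝ] B.AdjointFiber y)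
        (A.covAt σ (p <• g)) h : TangentSpace IM x →L[ℝ] B.AdjointFiber x) v =
      cls ⟨p <• g, h⟩ (mvfderiv IP (B.lift σ) (p <• g) (A.horLift (p <• g) v)) := by
    rintro _ rfl v
    exact A.covAt_apply σ _ v
  ext v
  refine (h7 _ _ v).trans ((cls_act (B.fib p) g _).trans ?_)
  refine Eq.trans ?_ (A.covAt_apply σ p v).symm
  exact congrArg (cls (B.fib p)) (key v).symm

end PrincipalConnection
end Connection

namespace PrincipalBundle

variable {B : PrincipalBundle IG IM IP G M P} [FiniteDimensional ℝ EG] [CompleteSpace EG]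

/-- The symmetric bilinear form on the fibers of the adjoint bundle induced by the Killing
form `κ` of `𝔤`, given by `K([p, ξ], [p, ζ]) = κ(ξ, ζ)` for every `p`, see `killing_cls`. -/
def killing (B : PrincipalBundle IG IM IP G M P) (x : M) :
    B.AdjointFiber x →L[ℝ] B.AdjointFiber x →L[ℝ] ℝ :=
  LinearMap.toContinuousBilinearMap
    ((killingForm ℝ (GroupLieAlgebra IG G)).compl₁₂
      ((clsL (pt (B := B) x)).symm : B.AdjointFiber x →ₗ[ℝ] GroupLieAlgebra IG G)
      ((clsL (pt (B := B) x)).symm : B.AdjointFiber x →ₗ[ℝ] GroupLieAlgebra IG G))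

theorem killing_cls {x : M} (p : B.Fiber x) (ξ ζ : GroupLieAlgebra IG G) :
    B.killing x (cls p ξ) (cls p ζ) = killingForm ℝ (GroupLieAlgebra IG G) ξ ζ := by
  obtain ⟨g, rfl⟩ := (pt (B := B) x).exists_act p
  rw [cls_act, cls_act, ← clsL_apply, ← clsL_apply]
  change killingForm ℝ (GroupLieAlgebra IG G) ((clsL (pt x)).symm (clsL (pt x) _))
    ((clsL (pt x)).symm (clsL (pt x) _)) = _
  rw [ContinuousLinearEquiv.symm_apply_apply, ContinuousLinearEquiv.symm_apply_apply,
    killingForm_Ad]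

end PrincipalBundle

end Principal
end
end MetricConnection

/-! A section `σ` of the adjoint bundle is the same as an equivariant function `s = lift σ` from `P`
to `𝔤`. Since the Killing form `κ` is invariant under `Ad`, the fiber form `K` can be evaluated at
any point of the fiber of `P`, so `K(σ, τ) ∘ π = κ(s, t)` on `P`, where `κ` is one fixed bilinear
form (`killing_eq_clsL_symm`). Differentiating this along the horizontal lift of `v` gives `d(K(σ,
τ))(v)` on the left, because `dπ` maps the lift back to `v`. On the right the product rule for `κ`
gives `κ(ds, t) + κ(s, dt)`, and the horizontal derivatives of `s` and `t` represent `∇σ` and `∇τ`.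
This is `isMetric_cov`.

The second claim follows formally from the first. If `ẽ` extends `e`, the dual connection satisfies
`(∇*_v ♭σ)(e) = d(K(σ, ẽ))(v) - K(σ, ∇_v ẽ)`, and metricity leaves `K(∇_v σ, e)`. Hence `∇* ∘ ♭ = ♭
∘ ∇` on sections (`dualConnection_flat`). Both exterior derivatives are alternating sums of
covariant derivatives of the sections obtained by inserting the same constant-coefficient fields
into the form, so the identity for sections gives the one for forms term by term (`extDeriv_flat`).

The analytic point is that `dualConnection` and `extDeriv` take the value zero at points where
differentiability fails. It must therefore be checked that `♭` preserves differentiability of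
sections (`diffAt_killing_flat`); this holds because `K` has constant coefficients in the
trivializations induced from `P`. -/

namespace MetricConnection

/-! ### Metric connections on a general vector bundle and their duals. -/

section Generic
variable {E : Type*} [NormedAddCommGroup E] [NormedSpace ℝ E] [FiniteDimensional ℝ E]
  {H : Type*} [TopologicalSpace H] {I : ModelWithCorners ℝ E H}
  {M : Type*} [TopologicalSpace M] [ChartedSpace H M]
  {F : Type*} [NormedAddCommGroup F] [NormedSpace ℝ F]
  {V : M → Type*} [TopologicalSpace (TotalSpace F V)]
  [∀ x, AddCommGroup (V x)] [∀ x, Module ℝ (V x)]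
  [∀ x, TopologicalSpace (V x)] [∀ x, IsTopologicalAddGroup (V x)] [∀ x, ContinuousSMul ℝ (V x)]
  [FiberBundle F V] [VectorBundle ℝ F V]

/-- The dual of a metric connection intertwines with `♭`: `∇* (♭ σ) = ♭ (∇ σ)`. -/
theorem IsMetric.dualConnection_flat [FiniteDimensional ℝ F] [ContMDiffVectorBundle 1 F V I]
    {D : CovariantDerivative I F V} {b : Π x, V x →L[ℝ] V x →L[ℝ] ℝ} (hD : IsMetric D b)
    {σ : Π x, V x} {x : M} (hσ : DiffAt I F σ x)
    (hbσ : DiffAt I (F →L[ℝ] ℝ) (V := Dual V) (fun y => b y (σ y)) x) (v : TangentSpace I x) :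
    dualConnection D (fun y => b y (σ y)) x v = b x (D σ x v) := by
  ext e
  have he : DiffAt I F (FiberBundle.extend F e) x := FiberBundle.mdifferentiableAt_extend I F e
  -- Differentiability of `♭σ` excludes the default value zero of `dualFun`.
  refine (dualFun_apply D hbσ v e).trans ?_
  -- Metricity is applied to `σ` and the extension of `e`; the term in which the extension is
  -- differentiated is exactly the one that the dual connection subtracts.
  rw [dualAux, (hD x σ _ hσ he).2 v, add_sub_cancel_right, FiberBundle.extend_apply_self]

/-! ### Vector-valued forms and the covariant exterior derivative. -/

variable [IsManifold I ∞ M]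

/-- The fields with constant coefficients in the preferred chart at `x` are smooth on its domain. -/
theorem smoothOn_constField (x : M) (w : TangentSpace I x) :
    SmoothOn I E (fun y => constField x y w)
      (trivializationAt E (TangentSpace I : M → Type _) x).baseSet := by
  refine ((trivializationAt E (TangentSpace I : M → Type _) x).contMDiffOn_section_baseSet_iff).2
    ((contMDiffOn_const (c := (trivializationAt E (TangentSpace I : M → Type _)
      x).continuousLinearMapAt ℝ x w)).congr fun y hy => ?_)
  simp only [constField, ContinuousLinearMap.comp_apply]
  -- Over the base set `symmL` really inverts the trivialization, so the coordinate of the field is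
  -- the constant coordinate of `w`.
  rw [Trivialization.symmL_apply _ hy, Trivialization.apply_mk_symm _ hy]

/-- A smooth form has differentiable coefficients. -/
theorem Form.IsSmooth.diffAt {k : ℕ} {φ : Form I V k} (hφ : φ.IsSmooth F) (x : M) :
    φ.DiffAt F x := fun w =>
  -- Smoothness of `φ` is tested on the chart domain, because the constant-coefficient fields are
  -- only known to be smooth there; this domain is a neighbourhood of `x`.
  ((hφ _ (fun i y => constField x y (w i))
    (trivializationAt E (TangentSpace I : M → Type _) x).open_baseSet
    (fun i => smoothOn_constField x (w i))).contMDiffAt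
      ((trivializationAt E (TangentSpace I : M → Type _) x).open_baseSet.mem_nhds
        (mem_baseSet_trivializationAt E (TangentSpace I) x))).mdifferentiableAt (by simp)

/-- If `∇` is metric with respect to `b` and `♭` preserves differentiability of sections, then
`♭ ∘ d^∇ = d^{∇*} ∘ ♭` on smooth forms. -/
theorem IsMetric.extDeriv_flat [FiniteDimensional ℝ F] [ContMDiffVectorBundle 1 F V I]
    {D : CovariantDerivative I F V} {b : Π x, V x →L[ℝ] V x →L[ℝ] ℝ} (hD : IsMetric D b)
    (hb : ∀ (x : M) (σ : Π y, V y), MetricConnection.DiffAt I F σ x →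
      MetricConnection.DiffAt I (F →L[ℝ] ℝ) (V := Dual V) (fun y => b y (σ y)) x)
    {k : ℕ} {φ : Form I V k} (hφ : φ.IsSmooth F) :
    (extDeriv D φ).flat b = extDeriv (dualConnection D) (φ.flat b) := by
  ext1 x
  have hφx := hφ.diffAt x
  -- Inserting fields commutes with `♭` by definition, so `hb` applies to each coefficient. With
  -- this, both exterior derivatives are given by the sum formula and not by the default zero.
  have hflat : (φ.flat b).DiffAt (F →L[ℝ] ℝ) x := fun w => hb x _ (hφx w)
  ext1 v
  rw [extDeriv_apply _ hflat]
  refine (congrArg (b x) (extDeriv_apply D hφx v)).trans ?_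
  rw [map_sum]
  refine Finset.sum_congr rfl fun i _ => ?_
  -- The signs `(-1)^i` are integer scalars, which the fiberwise linear map `♭` respects.
  rw [map_zsmul]
  exact congrArg _ (hD.dualConnection_flat (hφx _) (hb x _ (hφx _)) (v i)).symm

end Generic

/-! ### The Killing form on the adjoint bundle: local coordinates and regularity. -/

section Principal
open scoped RightActions
open PrincipalBundle

variable {EG : Type*} [NormedAddCommGroup EG] [NormedSpace ℝ EG]
  [FiniteDimensional ℝ EG] [CompleteSpace EG]
  {HG : Type*} [TopologicalSpace HG] {IG : ModelWithCorners ℝ EG HG}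
  {EM : Type*} [NormedAddCommGroup EM] [NormedSpace ℝ EM]
  {HM : Type*} [TopologicalSpace HM] {IM : ModelWithCorners ℝ EM HM}
  {EP : Type*} [NormedAddCommGroup EP] [NormedSpace ℝ EP]
  {HP : Type*} [TopologicalSpace HP] {IP : ModelWithCorners ℝ EP HP}
  {G : Type*} [TopologicalSpace G] [ChartedSpace HG G] [Group G] [LieGroup IG ∞ G]
  {M : Type*} [TopologicalSpace M] [ChartedSpace HM M]
  {P : Type*} [TopologicalSpace P] [ChartedSpace HP P] [MulAction Gᵐᵒᵖ P]
  {B : PrincipalBundle IG IM IP G M P}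

variable (IG G) in
/-- The Killing form as a continuous bilinear form on the model space `E` of `𝔤`. -/
noncomputable def killingL : EG →L[ℝ] EG →L[ℝ] ℝ :=
  LinearMap.toContinuousBilinearMap
    (killingForm ℝ (GroupLieAlgebra IG G) : EG →ₗ[ℝ] EG →ₗ[ℝ] ℝ)

namespace PrincipalBundle

/-- The Killing form of the fiber in the identification with `𝔤` given by a point of `P`. -/
theorem killing_eq_clsL_symm {x : M} (p : B.Fiber x) (e f : B.AdjointFiber x) :
    B.killing x e f = killingL IG G ((clsL p).symm e) ((clsL p).symm f) := by
  obtain ⟨ξ, rfl⟩ := (clsL p).surjective e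
  obtain ⟨ζ, rfl⟩ := (clsL p).surjective f
  -- The `Ad`-invariance of the Killing form enters here, through `killing_cls`: it makes the
  -- arbitrary point `p` as good as the auxiliary one in the definition of `killing`.
  rw [ContinuousLinearEquiv.symm_apply_apply, ContinuousLinearEquiv.symm_apply_apply,
    clsL_apply, clsL_apply, killing_cls]
  rfl

/-- The coordinate of a differentiable section in the preferred trivialization. -/
theorem mdifferentiableAt_pretriv {σ : Π x, B.AdjointFiber x} {x : M} (hσ : DiffAt IM EG σ x) :
    MDifferentiableAt IM 𝓘(ℝ, EG)
      (fun y => (pretriv (B.exists_triv x).choose ⟨y, σ y⟩).2) x :=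
  -- The preferred trivialization of the adjoint bundle at `x` is by construction the one induced by
  -- the chosen trivialization of `P`, so the two coordinate functions agree definitionally.
  (mdifferentiableAt_section (IB := IM) (F := EG) σ).1 hσ

/-- In a trivialization induced from `P`, the form `K` is the fixed bilinear form `κ`, so only the
coordinates of the two sections vary with the base point. -/
theorem mdifferentiableAt_killing {σ τ : Π x, B.AdjointFiber x} {x : M}
    (hσ : DiffAt IM EG σ x) (hτ : DiffAt IM EG τ x) :
    MDifferentiableAt IM 𝓘(ℝ, ℝ) (fun y => B.killing y (σ y) (τ y)) x := by
  have hκ : MDifferentiableAt IM 𝓘(ℝ, EG →L[ℝ] ℝ)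
      (fun y => killingL IG G (pretriv (B.exists_triv x).choose ⟨y, σ y⟩).2) x :=
    (killingL IG G).mdifferentiableAt.comp x (mdifferentiableAt_pretriv hσ)
  refine (hκ.clm_apply (mdifferentiableAt_pretriv hτ)).congr_of_eventuallyEq
    -- The identity holds for every `y`, even outside the base set: there `framePt` is the auxiliary
    -- point, which still lies in the fiber over `y`.
    (Filter.Eventually.of_forall fun y => ?_)
  exact killing_eq_clsL_symm (framePt _ y) (σ y) (τ y)

/-- In coordinates near `x` the covector `♭σ` is `κ(s, ·)`, where `s` is the coordinate of `σ`,
hence a fixed continuous linear map applied to a differentiable function. This is the regularity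
hypothesis of `extDeriv_flat`. -/
theorem diffAt_killing_flat {σ : Π x, B.AdjointFiber x} {x : M} (hσ : DiffAt IM EG σ x) :
    DiffAt IM (EG →L[ℝ] ℝ) (V := Dual B.AdjointFiber) (fun y => B.killing y (σ y)) x := by
  have hκ : MDifferentiableAt IM 𝓘(ℝ, EG →L[ℝ] ℝ)
      (fun y => killingL IG G (pretriv (B.exists_triv x).choose ⟨y, σ y⟩).2) x :=
    (killingL IG G).mdifferentiableAt.comp x (mdifferentiableAt_pretriv hσ)
  refine (mdifferentiableAt_hom_bundle (E₂ := Bundle.Trivial M ℝ) _).2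
    ⟨mdifferentiableAt_id, hκ.congr_of_eventuallyEq ?_⟩
  have hx : x ∈ (B.exists_triv x).choose.baseSet := (B.exists_triv x).choose_spec
  -- The restriction to the base set is needed because the inverse of the trivialization, which
  -- enters the coordinates of a covector, is described by `framePt` only there.
  filter_upwards [(B.exists_triv x).choose.open_baseSet.mem_nhds hx] with y hy
  ext v
  have h : (trivializationAt EG B.AdjointFiber x).symmL ℝ y v =
      clsL (framePt (B.exists_triv x).choose y) v := by
    rw [Trivialization.symmL_apply _ hy]
    exact pretriv_symm _ hy v
  simp only [ContinuousLinearMap.inCoordinates, ContinuousLinearMap.comp_apply, h]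
  -- The target is the trivial line bundle, whose coordinate map is the identity.
  refine (congrArg (fun T : ℝ →L[ℝ] ℝ => T _)
    (Trivial.continuousLinearMapAt_trivialization ℝ M ℝ y)).trans ?_
  refine (killing_eq_clsL_symm (framePt (B.exists_triv x).choose y) _ _).trans ?_
  exact congrArg _ ((clsL (framePt (B.exists_triv x).choose y)).symm_apply_apply v)

end PrincipalBundle

/-! ### Metricity of the induced connection. -/

/-- The connection on the adjoint bundle induced by a principal connection is metric with respect
to the Killing form. -/
theorem PrincipalConnection.isMetric_cov [IsManifold IP 1 P] (A : PrincipalConnection B) :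
    IsMetric A.cov B.killing := by
  intro x σ τ hσ hτ
  have hK := mdifferentiableAt_killing hσ hτ
  refine ⟨hK, fun v => ?_⟩
  obtain ⟨p, rfl⟩ := (inferInstance : Nonempty (B.Fiber x))
  have hs := (mdifferentiableAt_lift hσ).hasMFDerivAt
  have ht := (mdifferentiableAt_lift hτ).hasMFDerivAt
  -- Pulled back to `P`, the function is `κ(s, t)` for the lifts `s`, `t`, and its derivative is the
  -- product rule for a fixed bilinear map.
  have h1 : (mfderiv IP 𝓘(ℝ, ℝ) ((fun y => B.killing y (σ y) (τ y)) ∘ B.proj) p : EP →L[ℝ] ℝ) =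
      (killingL IG G).deriv₂ (B.lift σ p, B.lift τ p) ∘L
        (mfderiv IP 𝓘(ℝ, EG) (B.lift σ) p : EP →L[ℝ] EG).prod
          (mfderiv IP 𝓘(ℝ, EG) (B.lift τ) p : EP →L[ℝ] EG) := by
    have h2 : (fun y => B.killing y (σ y) (τ y)) ∘ B.proj =
        (fun z : EG × EG => killingL IG G z.1 z.2) ∘ fun q => (B.lift σ q, B.lift τ q) := by
      ext q; exact killing_eq_clsL_symm (B.fib q) _ _
    rw [h2]
    exact (HasMFDerivAt.comp p
      ((killingL IG G).isBoundedBilinearMap.hasFDerivAt (B.lift σ p, B.lift τ p)).hasMFDerivAt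
      -- Continuity and the derivative in coordinates are paired separately, so that the target is
      -- the normed space `EG × EG` with its own model, as in the derivative of `κ`.
      ⟨hs.1.prodMk ht.1, hs.2.prodMk ht.2⟩).mfderiv
  have h3 := mfderiv_comp p hK (mdiff_proj B p)
  -- The derivative on `M` is read off on `P`, since the horizontal lift projects to `v`.
  have h4 : mvfderiv IM (fun y => B.killing y (σ y) (τ y)) (B.proj p) v =
      (mfderiv IP 𝓘(ℝ, ℝ) ((fun y => B.killing y (σ y) (τ y)) ∘ B.proj) p : EP →L[ℝ] ℝ)
        (A.horLift p v) := by
    refine Eq.trans ?_ (congrArg (fun T : EP →L[ℝ] ℝ => T (A.horLift p v)) h3).symm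
    exact congrArg (mfderiv IM 𝓘(ℝ, ℝ) (fun y => B.killing y (σ y) (τ y)) (B.proj p) :
      EM →L[ℝ] ℝ) (A.mfderiv_proj_horLift p v).symm
  have h5 (ρ : Π x, B.AdjointFiber x) (hρ : DiffAt IM EG ρ (B.proj p)) :
      (clsL (B.fib p)).symm (A.cov ρ (B.proj p) v) =
        mvfderiv IP (B.lift ρ) p (A.horLift p v) := by
    -- By equivariance the connection can be computed at the present `p` instead of the auxiliary
    -- point in its definition.
    rw [A.cov_eq_covAt hρ, A.covAt_apply]
    exact (congrArg (clsL (B.fib p)).symm (clsL_apply _ _).symm).trans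
      ((clsL (B.fib p)).symm_apply_apply _)
  rw [h4, h1, killing_eq_clsL_symm (B.fib p), killing_eq_clsL_symm (B.fib p), h5 σ hσ, h5 τ hτ]
  -- `deriv₂` lists the term differentiating the second argument first.
  exact add_comm _ _

end Principal

end MetricConnection

/-- For a compact semisimple Lie group `G`, the connection `∇^A` that a principal connection `A` on
a principal `G`-bundle `P → M` induces on the adjoint bundle is metric with respect to the Killing
form, and `♭ ∘ d^A = d^{A*} ∘ ♭` on forms of all degrees with values in the adjoint bundle. -/
theorem lemma3p10
    -- the structure group, a Lie group
    {EG : Type*} [NormedAddCommGroup EG] [NormedSpace ℝ EG] [FiniteDimensional ℝ EG]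
    [CompleteSpace EG] {HG : Type*} [TopologicalSpace HG] {IG : ModelWithCorners ℝ EG HG}
    {G : Type*} [TopologicalSpace G] [ChartedSpace HG G] [Group G] [LieGroup IG ∞ G]
    -- the base manifold, possibly with boundary
    {EM : Type*} [NormedAddCommGroup EM] [NormedSpace ℝ EM] [FiniteDimensional ℝ EM]
    {HM : Type*} [TopologicalSpace HM] {IM : ModelWithCorners ℝ EM HM}
    {M : Type*} [TopologicalSpace M] [ChartedSpace HM M] [IsManifold IM ∞ M]
    -- the total space of the principal bundle
    {EP : Type*} [NormedAddCommGroup EP] [NormedSpace ℝ EP]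
    {HP : Type*} [TopologicalSpace HP] {IP : ModelWithCorners ℝ EP HP}
    {P : Type*} [TopologicalSpace P] [ChartedSpace HP P] [IsManifold IP ∞ P] [MulAction Gᵐᵒᵖ P]
    [CompactSpace G] [LieAlgebra.IsSemisimple ℝ (GroupLieAlgebra IG G)]
    (B : MetricConnection.PrincipalBundle IG IM IP G M P)
    (A : MetricConnection.PrincipalConnection B) :
    MetricConnection.IsMetric A.cov B.killing ∧
    ∀ (k : ℕ) (φ : MetricConnection.Form IM B.AdjointFiber k), φ.IsSmooth EG →
      (MetricConnection.extDeriv A.cov φ).flat B.killing =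
        MetricConnection.extDeriv (MetricConnection.dualConnection A.cov) (φ.flat B.killing) := by
  exact ⟨A.isMetric_cov, fun _ _ hφ => A.isMetric_cov.extDeriv_flat
    (fun _ _ hσ => MetricConnection.PrincipalBundle.diffAt_killing_flat hσ) hφ⟩
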